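/- Let $n\ge 1$ and let $w$ be a weight on $\mathbb R^n$, i.e. a non-negative locally integrable function; write $w(E)=\int_E w(x)\,dx$ for measurable $E\subseteq\mathbb R^n$. For a weight $v$ on $\mathbb R$ put \[ [v]_{A_\infty}=\sup_I \frac1{v(I)}\int_I \mathsf M(v\mathbf 1_I)(t)\,dt,\qquad \mathsf M f(t)=\sup_{I\ni t}\frac1{|I|}\int_I|f|, \] the suprema being over bounded nondegenerate intervals $I$ (with $0/0=0$). For $1\le j\le n$ and $\bar x^j=(x_1,\dots,x_{j-1},x_{j+1},\dots,x_n)\in\mathbb R^{n-1}$ let $w_{\bar x^j}(t)=w(x_1,\dots,x_{j-1},t,x_{j+1},\dots,x_n)$. Assume that $w\in A_\infty^*$ is a strong Muckenhoupt weight, i.e. \[ [w]_{A_\infty^*}=\sup_{1\le j\le n}\ \operatorname*{ess\,sup}_{\bar x^j\in\mathbb R^{n-1}}\,[w_{\bar x^j}]_{A_\infty}<\infty . \] Let $\mathsf M_{\mathsf S,w}f(x)=\sup_{R\ni x}\frac1{w(R)}\int_R|f|\,w\,dy$, where the supremum is over bounded nondegenerate rectangular parallelepipeds $R\ni x$ with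 sides parallel to the coordinate axes (again with $0/0=0$), and for $\alpha\in(0,1)$ let \[ \mathsf C_{\mathsf S,w}^{w}(\alpha)=\sup_{E\subseteq\mathbb R^n \text{ measurable},\ 0<w(E)<\infty}\ \frac{w(\{x\in\mathbb R^n:\ \mathsf M_{\mathsf S,w}(\mathbf 1_E)(x)>\alpha\})}{w(E)} . \] Then there are constants $c_{w,n}>0$, $K_{w,n}>0$ and $\alpha_{w,n}\in(0,1)$, depending only on $w$ and $n$, such that \[ \mathsf C_{\mathsf S,w}^{w}(\alpha)-1\le K_{w,n}\,(1-\alpha)^{c_{w,n}}\qquad\text{for all }\alpha_{w,n}<\alpha<1 . \] -/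

import Mathlib

open MeasureTheory Filter Topology
open scoped ENNReal

noncomputable section

/-- The uncentered Hardy–Littlewood maximal operator on the real line,
`M f (x) = sup_{I ∋ x} |I|⁻¹ ∫_I |f|`, the supremum being over bounded nondegenerate intervals. -/
def maximalOne (f : ℝ → ℝ) (x : ℝ) : ℝ≥0∞ :=
  ⨆ (a : ℝ) (b : ℝ) (_ : a < b) (_ : x ∈ Set.Icc a b),
    (∫⁻ y in Set.Icc a b, ‖f y‖ₑ) / volume (Set.Icc a b)

/-- The measure `w(x) dx` attached to a weight `w` on `ℝⁿ`. -/
def weightMeasure {n : ℕ} (w : (Fin n → ℝ) → ℝ) : Measure (Fin n → ℝ) :=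
  volume.withDensity fun x => ENNReal.ofReal (w x)

/-- The Fujii–Wilson constant of a weight on the real line,
`[v]_{A_∞} = sup_I v(I)⁻¹ ∫_I M(v 1_I)`, over bounded nondegenerate intervals `I`
(an interval on which `v` vanishes almost everywhere contributes `0 / 0 = 0`). -/
def aInftyConst (v : ℝ → ℝ) : ℝ≥0∞ :=
  ⨆ (a : ℝ) (b : ℝ) (_ : a < b),
    (∫⁻ x in Set.Icc a b, maximalOne ((Set.Icc a b).indicator v) x) /
      ∫⁻ x in Set.Icc a b, ENNReal.ofReal (v x)

/-- The one-dimensional slice of `w` in the `j`-th coordinate direction: the `j`-th coordinate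
is the variable `t`, and the other coordinates are given by `y`. -/
def slice {n : ℕ} (w : (Fin n → ℝ) → ℝ) (j : Fin n) (y : {i : Fin n // i ≠ j} → ℝ) : ℝ → ℝ :=
  fun t => w fun i => if h : i = j then t else y ⟨i, h⟩

/-- The strong `A_∞` constant: the supremum over the coordinate directions `j` of the essential
supremum, over the other `n - 1` coordinates, of the `A_∞` constants of the slices. -/
def strongAInftyConst {n : ℕ} (w : (Fin n → ℝ) → ℝ) : ℝ≥0∞ :=
  ⨆ j : Fin n, essSup (fun y : {i : Fin n // i ≠ j} → ℝ => aInftyConst (slice w j y)) volume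

/-- Strong Muckenhoupt weights, the class `A_∞^*`: non-negative locally integrable functions on
`ℝⁿ` with finite strong `A_∞` constant. -/
structure IsStrongAInfty {n : ℕ} (w : (Fin n → ℝ) → ℝ) : Prop where
  nonneg : ∀ x, 0 ≤ w x
  locallyIntegrable : LocallyIntegrable w volume
  const_lt_top : strongAInftyConst w < ∞

/-- The strong maximal operator with respect to `w`,
`M_{S,w} f (x) = sup_{R ∋ x} w(R)⁻¹ ∫_R |f| w`, over bounded nondegenerate rectangular
parallelepipeds `R = ∏ i, [a i, b i]` with sides parallel to the axes. -/
def strongMaximal {n : ℕ} (w : (Fin n → ℝ) → ℝ) (f : (Fin n → ℝ) → ℝ) (x : Fin n → ℝ) : ℝ≥0∞ :=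
  ⨆ (a : Fin n → ℝ) (b : Fin n → ℝ) (_ : ∀ i, a i < b i) (_ : x ∈ Set.Icc a b),
    (∫⁻ y in Set.Icc a b, ‖f y‖ₑ ∂(weightMeasure w)) / weightMeasure w (Set.Icc a b)

/-- The sharp Tauberian constant of `M_{S,w}` with respect to `w`: the supremum of
`w({M_{S,w}(1_E) > α}) / w(E)` over measurable `E` with `0 < w(E) < ∞`. -/
def tauberianConst {n : ℕ} (w : (Fin n → ℝ) → ℝ) (α : ℝ) : ℝ≥0∞ :=
  ⨆ (E : Set (Fin n → ℝ)) (_ : MeasurableSet E)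
    (_ : 0 < weightMeasure w E) (_ : weightMeasure w E < ∞),
    weightMeasure w {x | ENNReal.ofReal α < strongMaximal w (E.indicator fun _ => 1) x} /
      weightMeasure w E

end

/-!
On almost every line parallel to an axis, `w` restricts to a one-dimensional `A_∞` weight, with one
and the same bound on its constant. Intervals selected by a continuity (Calderón–Zygmund) stopping
argument turn that bound into Coifman–Fefferman comparability of `w dt` and `dt`, and iterating the
argument turns this into a power estimate in each direction.

Suppose `E` misses only a proportion `η ^ (m n)` of the `w`-measure of a box. Then, filling in one
coordinate after the other those chords of the box on which little is missing in Lebesgue measure,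
one recovers the whole box. All these fillings, for all boxes at once, lie in `n` successive
one-dimensional fillings of `E` along segments, and comparability on lines shows that each of them
multiplies the `w`-measure by at most `(1 - 2 (3/4) ^ m)⁻¹`. Choosing `m` proportional to
`|log (1 - α)|` gives the Hölder estimate at `α = 1`.
-/

section Covering

open Classical in
/-- The overlap of a finite family of sets: `OverlapLE t J N` says that every point lies in at most
`N` of the sets `J i`, `i ∈ t`. It controls `∑ μ (J i)` by `μ (⋃ J i)`. -/
def OverlapLE {ι X : Type*} (t : Finset ι) (J : ι → Set X) (N : ℕ) : Prop :=
  ∀ y, {i ∈ t | y ∈ J i}.card ≤ N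

theorem OverlapLE.sum_measure_le {ι X : Type*} [MeasurableSpace X] {t : Finset ι} {J : ι → Set X}
    {N : ℕ} (h : OverlapLE t J N) (hJ : ∀ i ∈ t, MeasurableSet (J i)) (μ : Measure X) :
    ∑ i ∈ t, μ (J i) ≤ N * μ (⋃ i ∈ t, J i) := by
  classical
  have pointwise : ∀ y, ∑ i ∈ t, (J i).indicator (1 : X → ℝ≥0∞) y ≤
      (⋃ i ∈ t, J i).indicator (fun _ => (N : ℝ≥0∞)) y := by
    intro y
    have hsum : ∑ i ∈ t, (J i).indicator (1 : X → ℝ≥0∞) y = {i ∈ t | y ∈ J i}.card := by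
      simp only [Set.indicator_apply, Pi.one_apply, Finset.sum_boole]
    by_cases hy : y ∈ ⋃ i ∈ t, J i
    · rw [hsum, Set.indicator_of_mem hy]
      exact_mod_cast h y
    · simp only [Set.mem_iUnion, not_exists] at hy
      rw [Finset.sum_eq_zero fun i hi => Set.indicator_of_notMem (hy i hi) _]
      exact zero_le
  calc ∑ i ∈ t, μ (J i)
      = ∫⁻ y, ∑ i ∈ t, (J i).indicator (1 : X → ℝ≥0∞) y ∂μ := by
        rw [lintegral_finsetSum' _ fun i hi => (measurable_one.indicator (hJ i hi)).aemeasurable]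
        exact Finset.sum_congr rfl fun i hi => (lintegral_indicator_one (hJ i hi)).symm
    _ ≤ ∫⁻ y, (⋃ i ∈ t, J i).indicator (fun _ => (N : ℝ≥0∞)) y ∂μ := lintegral_mono pointwise
    _ = N * μ (⋃ i ∈ t, J i) := lintegral_indicator_const (t.measurableSet_biUnion hJ) _

theorem OverlapLE.sum_measureReal_le {ι X : Type*} [MeasurableSpace X] {t : Finset ι}
    {J : ι → Set X} {N : ℕ} (h : OverlapLE t J N) (hJ : ∀ i ∈ t, MeasurableSet (J i))
    {μ : Measure X} (hμ : μ (⋃ i ∈ t, J i) ≠ ∞) :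
    ∑ i ∈ t, μ.real (J i) ≤ N * μ.real (⋃ i ∈ t, J i) := by
  have hfin : ∀ i ∈ t, μ (J i) ≠ ∞ := fun i hi =>
    measure_ne_top_of_subset (Set.subset_biUnion_of_mem (u := J) hi) hμ
  have := ENNReal.toReal_mono (ENNReal.mul_ne_top (by simp) hμ) (h.sum_measure_le hJ μ)
  rwa [ENNReal.toReal_sum hfin, ENNReal.toReal_mul, ENNReal.toReal_natCast] at this

theorem OverlapLE.measureReal_biUnion_inter_le {ι X : Type*} [MeasurableSpace X] {t : Finset ι}
    {J : ι → Set X} {N : ℕ} (h : OverlapLE t J N) (hJ : ∀ i ∈ t, MeasurableSet (J i))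
    {ρ μ : Measure X} (hμ : μ (⋃ i ∈ t, J i) ≠ ∞) {κ : ℝ} (hκ : 0 ≤ κ) {G : Set X}
    (hJG : ∀ i ∈ t, ρ.real (J i ∩ G) ≤ κ * μ.real (J i)) :
    ρ.real ((⋃ i ∈ t, J i) ∩ G) ≤ κ * N * μ.real (⋃ i ∈ t, J i) :=
  calc ρ.real ((⋃ i ∈ t, J i) ∩ G) ≤ ∑ i ∈ t, ρ.real (J i ∩ G) := by
        rw [Set.iUnion₂_inter]
        exact measureReal_biUnion_finset_le _ _
    _ ≤ κ * ∑ i ∈ t, μ.real (J i) := by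
        rw [Finset.mul_sum]
        exact Finset.sum_le_sum hJG
    _ ≤ κ * N * μ.real (⋃ i ∈ t, J i) := by
        rw [mul_assoc]
        exact mul_le_mul_of_nonneg_left (h.sum_measureReal_le hJ hμ) hκ

theorem OverlapLE.mul_measureReal_biUnion_le {ι X : Type*} [MeasurableSpace X] {t : Finset ι}
    {J : ι → Set X} {N : ℕ} (h : OverlapLE t J N) (hJ : ∀ i ∈ t, MeasurableSet (J i))
    {μ : Measure X} (hμ : μ (⋃ i ∈ t, J i) ≠ ∞) {c : ℝ} (hc : 0 ≤ c) {G : Set X}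
    (hJG : ∀ i ∈ t, c * μ.real (J i) ≤ μ.real (J i ∩ G)) :
    c * μ.real (⋃ i ∈ t, J i) ≤ N * μ.real ((⋃ i ∈ t, J i) ∩ G) :=
  calc c * μ.real (⋃ i ∈ t, J i) ≤ c * ∑ i ∈ t, μ.real (J i) :=
        mul_le_mul_of_nonneg_left (measureReal_biUnion_finset_le _ _) hc
    _ ≤ ∑ i ∈ t, (μ.restrict G).real (J i) := by
        rw [Finset.mul_sum]
        refine Finset.sum_le_sum fun i hi => ?_
        rw [measureReal_restrict_apply (hJ i hi)]
        exact hJG i hi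
    _ ≤ N * (μ.restrict G).real (⋃ i ∈ t, J i) :=
        h.sum_measureReal_le hJ ((Measure.restrict_apply_le _ _).trans_lt hμ.lt_top).ne
    _ = N * μ.real ((⋃ i ∈ t, J i) ∩ G) := by
        rw [measureReal_restrict_apply (t.measurableSet_biUnion hJ)]

theorem OverlapLE.mul_measureReal_biUnion_inter_le {ι X : Type*} [MeasurableSpace X] {t : Finset ι}
    {J : ι → Set X} {N : ℕ} (h : OverlapLE t J N) (hJ : ∀ i ∈ t, MeasurableSet (J i))
    {μ : Measure X} (hμ : μ (⋃ i ∈ t, J i) ≠ ∞) {θ : ℝ} (hθ : θ ≤ 1) {G : Set X}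
    (hG : MeasurableSet G) (hJG : ∀ i ∈ t, μ.real (J i ∩ G) ≤ θ * μ.real (J i)) :
    N * μ.real ((⋃ i ∈ t, J i) ∩ G) ≤ (N - 1 + θ) * μ.real (⋃ i ∈ t, J i) := by
  have outside := h.mul_measureReal_biUnion_le hJ hμ (sub_nonneg.2 hθ) (G := Gᶜ) fun i hi => by
    have := measureReal_inter_add_sdiff (s := J i) hG
      (measure_ne_top_of_subset (Set.subset_biUnion_of_mem (u := J) hi) hμ)
    rw [← Set.sdiff_eq]
    linarith [hJG i hi]
  rw [← Set.sdiff_eq] at outside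
  nlinarith [measureReal_inter_add_sdiff (s := ⋃ i ∈ t, J i) hG hμ]

variable {α : Type*} [LinearOrder α]

theorem exists_Icc_subset_biUnion_erase {s : Finset (α × α)} {y : α}
    (hy : ∀ I ∈ s, y ∈ Set.Icc I.1 I.2) (hs : 2 < s.card) :
    ∃ I ∈ s, Set.Icc I.1 I.2 ⊆ ⋃ J ∈ s.erase I, Set.Icc J.1 J.2 := by
  have hne : s.Nonempty := Finset.card_pos.1 (by lia)
  obtain ⟨P, hP, leftmost⟩ := s.exists_min_image Prod.fst hne
  obtain ⟨Q, hQ, rightmost⟩ := s.exists_max_image Prod.snd hne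
  obtain ⟨I, hI, hIPQ⟩ : ∃ I ∈ s, I ∉ ({P, Q} : Finset (α × α)) :=
    Finset.exists_mem_notMem_of_card_lt_card (Finset.card_le_two.trans_lt hs)
  simp only [Finset.mem_insert, Finset.mem_singleton, not_or] at hIPQ
  refine ⟨I, hI, fun x hx => ?_⟩
  rcases le_total x y with hxy | hxy
  · exact Set.mem_biUnion (Finset.mem_erase.2 ⟨Ne.symm hIPQ.1, hP⟩)
      ⟨(leftmost I hI).trans hx.1, hxy.trans (hy P hP).2⟩
  · exact Set.mem_biUnion (Finset.mem_erase.2 ⟨Ne.symm hIPQ.2, hQ⟩)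
      ⟨(hy Q hQ).1.trans hxy, hx.2.trans (rightmost I hI)⟩

theorem exists_subset_overlapLE_two (s : Finset (α × α)) :
    ∃ t ⊆ s, (⋃ I ∈ t, Set.Icc I.1 I.2) = (⋃ I ∈ s, Set.Icc I.1 I.2) ∧
      OverlapLE t (fun I => Set.Icc I.1 I.2) 2 := by
  classical
  induction s using Finset.strongInduction with
  | H s ih =>
    by_cases hs : OverlapLE s (fun I => Set.Icc I.1 I.2) 2
    · exact ⟨s, subset_rfl, rfl, hs⟩
    simp only [OverlapLE, not_forall, not_le] at hs
    obtain ⟨y, hy⟩ := hs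
    obtain ⟨I, hI, hIsub⟩ :=
      exists_Icc_subset_biUnion_erase (fun I hI => (Finset.mem_filter.1 hI).2) hy
    have hIs : I ∈ s := (Finset.mem_filter.1 hI).1
    obtain ⟨t, hts, hunion, hoverlap⟩ := ih (s.erase I) (Finset.erase_ssubset hIs)
    refine ⟨t, hts.trans (s.erase_subset I), hunion.trans ?_, hoverlap⟩
    conv_rhs => rw [← Finset.insert_erase hIs, Finset.set_biUnion_insert]
    exact (Set.union_eq_right.2 (hIsub.trans (Set.biUnion_mono
      (Finset.erase_subset_erase _ (s.filter_subset _)) fun _ _ => subset_rfl))).symm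

variable [TopologicalSpace α]

theorem exists_finset_Icc_cover_overlapLE_two {K : Set α} (hK : IsCompact K)
    {P : α × α → Prop} (h : ∀ x ∈ K, ∃ I : α × α, P I ∧ Set.Icc I.1 I.2 ∈ 𝓝[K] x) :
    ∃ t : Finset (α × α), (∀ I ∈ t, P I) ∧ K ⊆ ⋃ I ∈ t, Set.Icc I.1 I.2 ∧
      OverlapLE t (fun I => Set.Icc I.1 I.2) 2 := by
  classical
  choose! J hJ hJx using h
  obtain ⟨s, hsK, hcover⟩ := hK.elim_nhdsWithin_subcover (fun x => Set.Icc (J x).1 (J x).2) hJx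
  obtain ⟨t, hts, hunion, hoverlap⟩ := exists_subset_overlapLE_two (s.image J)
  refine ⟨t, fun I hI => ?_, ?_, hoverlap⟩
  · obtain ⟨x, hx, rfl⟩ := Finset.mem_image.1 (hts hI)
    exact hJ x (hsK x hx)
  · rwa [hunion, Finset.set_biUnion_finset_image]

end Covering

section StoppingIntervals

/-- The interval `[x - r, x + r]` clipped to `[a, b]`, as the pair of its endpoints. It grows
continuously with `r` and exhausts `[a, b]`. -/
def clippedInterval (a b x r : ℝ) : ℝ × ℝ :=
  (max a (x - r), min b (x + r))

variable {a b x r : ℝ}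

theorem clippedInterval_subset (a b x r : ℝ) :
    Set.Icc (clippedInterval a b x r).1 (clippedInterval a b x r).2 ⊆ Set.Icc a b :=
  Set.Icc_subset_Icc (le_max_left _ _) (min_le_left _ _)

theorem clippedInterval_lt (hab : a < b) (hx : x ∈ Set.Icc a b) (hr : 0 < r) :
    (clippedInterval a b x r).1 < (clippedInterval a b x r).2 := by
  simp only [clippedInterval, lt_min_iff, max_lt_iff]
  refine ⟨⟨hab, ?_⟩, ?_, ?_⟩ <;> linarith [hx.1, hx.2]

theorem clippedInterval_sub (hx : x ∈ Set.Icc a b) : clippedInterval a b x (b - a) = (a, b) :=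
  Prod.ext (max_eq_left (by linarith [hx.2])) (min_eq_left (by linarith [hx.1]))

theorem clippedInterval_mem_nhdsWithin (hr : 0 < r) :
    Set.Icc (clippedInterval a b x r).1 (clippedInterval a b x r).2 ∈ 𝓝[Set.Icc a b] x := by
  have hball : Set.Icc (x - r) (x + r) ∈ 𝓝[Set.Icc a b] x :=
    mem_nhdsWithin_of_mem_nhds (Icc_mem_nhds (by linarith) (by linarith))
  filter_upwards [hball, self_mem_nhdsWithin] with y hy hyab
  exact ⟨max_le hyab.1 hy.1, le_min hyab.2 hy.2⟩

theorem exists_clippedInterval_subset {U : Set ℝ} (hU : IsOpen U) (hx : x ∈ U) (a b : ℝ) :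
    ∃ r > 0, Set.Icc (clippedInterval a b x r).1 (clippedInterval a b x r).2 ⊆ U := by
  obtain ⟨r, hr, hball⟩ := Metric.nhds_basis_closedBall.mem_iff.1 (hU.mem_nhds hx)
  rw [Real.closedBall_eq_Icc] at hball
  exact ⟨r, hr, (Set.Icc_subset_Icc (le_max_right _ _) (min_le_right _ _)).trans hball⟩

theorem continuous_measureReal_Icc (μ : Measure ℝ) [IsLocallyFiniteMeasure μ]
    [NullSingletonClass μ] : Continuous fun p : ℝ × ℝ => μ.real (Set.Icc p.1 p.2) := by
  have integrable : ∀ p q, IntervalIntegrable (fun _ => (1 : ℝ)) μ p q := fun _ _ =>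
    intervalIntegrable_const
  let Φ : ℝ → ℝ := fun t => ∫ _ in (0 : ℝ)..t, (1 : ℝ) ∂μ
  have hΦ : Continuous Φ := intervalIntegral.continuous_primitive integrable 0
  have eq_primitive : ∀ p : ℝ × ℝ, μ.real (Set.Icc p.1 p.2) = Φ (max p.1 p.2) - Φ p.1 := by
    intro p
    rw [intervalIntegral.integral_interval_sub_left (integrable _ _) (integrable _ _),
      intervalIntegral.integral_of_le (le_max_left _ _), setIntegral_const, smul_eq_mul, mul_one]
    rcases le_total p.1 p.2 with h | h
    · rw [max_eq_right h, measureReal_congr Ioc_ae_eq_Icc]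
    · rw [max_eq_left h, Set.Ioc_self, measureReal_empty, measureReal_def,
        (Set.subsingleton_Icc_of_ge h).measure_zero, ENNReal.toReal_zero]
  simp only [eq_primitive]
  fun_prop

/-- A stopping interval for the ratio `ρ / σ` at level `c`, inside `[a, b]`: the ratio on it is at
most `c`, and exactly `c` unless the interval lies in `U`. -/
structure IsStoppingInterval (ρ σ : Measure ℝ) (c : ℝ) (U : Set ℝ) (a b : ℝ) (I : ℝ × ℝ) :
    Prop where
  lt : I.1 < I.2
  subset_Icc : Set.Icc I.1 I.2 ⊆ Set.Icc a b
  le : ρ.real (Set.Icc I.1 I.2) ≤ c * σ.real (Set.Icc I.1 I.2)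
  subset_or_eq : Set.Icc I.1 I.2 ⊆ U ∨ ρ.real (Set.Icc I.1 I.2) = c * σ.real (Set.Icc I.1 I.2)

variable {ρ σ : Measure ℝ} [IsLocallyFiniteMeasure ρ] [NullSingletonClass ρ]
  [IsLocallyFiniteMeasure σ] [NullSingletonClass σ] {c : ℝ} {U K : Set ℝ}

theorem exists_isStoppingInterval (hU : IsOpen U) (hab : a < b) (hx : x ∈ Set.Icc a b)
    (hxU : x ∈ U) (hroot : ρ.real (Set.Icc a b) ≤ c * σ.real (Set.Icc a b)) :
    ∃ I, IsStoppingInterval ρ σ c U a b I ∧ Set.Icc I.1 I.2 ∈ 𝓝[Set.Icc a b] x := by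
  let J : ℝ → ℝ × ℝ := clippedInterval a b x
  let gap : ℝ → ℝ := fun r =>
    c * σ.real (Set.Icc (J r).1 (J r).2) - ρ.real (Set.Icc (J r).1 (J r).2)
  have hJ : Continuous J := by unfold J clippedInterval; fun_prop
  have hgap : Continuous gap :=
    (((continuous_measureReal_Icc σ).comp hJ).const_mul c).sub
      ((continuous_measureReal_Icc ρ).comp hJ)
  suffices ∃ r > 0, 0 ≤ gap r ∧ (Set.Icc (J r).1 (J r).2 ⊆ U ∨ gap r = 0) by
    obtain ⟨r, hr, hle, hor⟩ := this
    exact ⟨J r, ⟨clippedInterval_lt hab hx hr, clippedInterval_subset a b x r, sub_nonneg.1 hle,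
      hor.imp_right fun h => (sub_eq_zero.1 h).symm⟩, clippedInterval_mem_nhdsWithin hr⟩
  by_cases hsmall : ∃ r₀ > 0, gap r₀ ≤ 0
  · obtain ⟨r₀, hr₀, hgap₀⟩ := hsmall
    have hgap₁ : 0 ≤ gap (b - a) := by
      simpa only [gap, J, clippedInterval_sub hx, sub_nonneg] using hroot
    obtain ⟨r, hr, hzero⟩ := intermediate_value_uIcc (hgap.continuousOn (s := Set.uIcc r₀ (b - a)))
      (Set.mem_uIcc_of_le hgap₀ hgap₁)
    exact ⟨r, (lt_min hr₀ (sub_pos.2 hab)).trans_le hr.1, hzero.ge, .inr hzero⟩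
  · push Not at hsmall
    obtain ⟨r, hr, hrU⟩ := exists_clippedInterval_subset hU hxU a b
    exact ⟨r, hr, (hsmall r hr).le, .inl hrU⟩

theorem exists_isStoppingInterval_cover (hU : IsOpen U) (hab : a < b) (hK : IsCompact K)
    (hKU : K ⊆ U) (hKab : K ⊆ Set.Icc a b)
    (hroot : ρ.real (Set.Icc a b) ≤ c * σ.real (Set.Icc a b)) :
    ∃ t : Finset (ℝ × ℝ), (∀ I ∈ t, IsStoppingInterval ρ σ c U a b I) ∧
      K ⊆ ⋃ I ∈ t, Set.Icc I.1 I.2 ∧ OverlapLE t (fun I => Set.Icc I.1 I.2) 2 := by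
  refine exists_finset_Icc_cover_overlapLE_two hK fun x hx => ?_
  obtain ⟨I, hI, hIx⟩ := exists_isStoppingInterval hU hab (hKab hx) (hKU hx) hroot
  exact ⟨I, hI, nhdsWithin_mono x hKab hIx⟩

end StoppingIntervals

section Regularity

variable {X : Type*} [TopologicalSpace X] [MeasurableSpace X] {μ : Measure X} {S : Set X}

theorem measureReal_le_of_forall_isCompact [μ.InnerRegularCompactLTTop]
    (hS : MeasurableSet S) (hfin : μ S ≠ ∞) {M : ℝ} (h : ∀ K ⊆ S, IsCompact K → μ.real K ≤ M) :
    μ.real S ≤ M := by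
  have hM : 0 ≤ M := by simpa using h ∅ (Set.empty_subset _) isCompact_empty
  by_contra! hlt
  obtain ⟨K, hKS, hK, hltK⟩ :=
    hS.exists_lt_isCompact_of_ne_top hfin ((ENNReal.ofReal_lt_iff_lt_toReal hM hfin).2 hlt)
  have hKfin : μ K ≠ ∞ := measure_ne_top_of_subset hKS hfin
  exact (h K hKS hK).not_gt ((ENNReal.ofReal_lt_iff_lt_toReal hM hKfin).1 hltK)

theorem exists_isOpen_measureReal_lt [μ.OuterRegular] (hS : μ S ≠ ∞) {c : ℝ} (h : μ.real S < c) :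
    ∃ U ⊇ S, IsOpen U ∧ μ U ≠ ∞ ∧ μ.real U < c := by
  obtain ⟨U, hSU, hU, hlt⟩ := S.exists_isOpen_lt_of_lt (ENNReal.ofReal c)
    ((ENNReal.lt_ofReal_iff_toReal_lt hS).2 h)
  exact ⟨U, hSU, hU, hlt.ne_top, (ENNReal.lt_ofReal_iff_toReal_lt hlt.ne_top).1 hlt⟩

theorem isLocallyFiniteMeasure_add (μ ν : Measure X) [IsLocallyFiniteMeasure μ]
    [IsLocallyFiniteMeasure ν] : IsLocallyFiniteMeasure (μ + ν) := by
  refine ⟨fun x => ?_⟩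
  obtain ⟨s, hs, hμs⟩ := μ.finiteAt_nhds x
  obtain ⟨t, ht, hνt⟩ := ν.finiteAt_nhds x
  exact ⟨s ∩ t, inter_mem hs ht, ENNReal.add_lt_top.2
    ⟨(measure_mono Set.inter_subset_left).trans_lt hμs,
      (measure_mono Set.inter_subset_right).trans_lt hνt⟩⟩

end Regularity

/-- The Coifman–Fefferman comparability condition between two measures on the line, at one pair of
parameters: a part of an interval carrying less than the proportion `δ` of its `μ`-measure carries
at most the proportion `ε` of its `ν`-measure. With a strict inequality in the hypothesis, the
condition says nothing about intervals of `μ`-measure zero. -/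
def ComparableOnIntervals (μ ν : Measure ℝ) (δ ε : ℝ) : Prop :=
  ∀ ⦃a b : ℝ⦄ ⦃F : Set ℝ⦄, a < b → MeasurableSet F → F ⊆ Set.Icc a b →
    μ.real F < δ * μ.real (Set.Icc a b) → ν.real F ≤ ε * ν.real (Set.Icc a b)

theorem measureReal_Icc_pos {μ : Measure ℝ} [IsLocallyFiniteMeasure μ] [μ.IsOpenPosMeasure]
    {a b : ℝ} (hab : a < b) : 0 < μ.real (Set.Icc a b) :=
  ENNReal.toReal_pos (Measure.measure_pos_of_nonempty_interior μ (by simpa using hab)).ne'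
    measure_Icc_lt_top.ne

theorem exists_cover_measureReal_inter_eq {μ : Measure ℝ} [IsLocallyFiniteMeasure μ]
    [NullSingletonClass μ] [μ.IsOpenPosMeasure] {a b c : ℝ} {U K : Set ℝ} (hU : IsOpen U)
    (hab : a < b) (hK : IsCompact K) (hKU : K ⊆ U) (hKab : K ⊆ Set.Icc a b) (hc1 : c < 1)
    (hroot : μ.real (Set.Icc a b ∩ U) ≤ c * μ.real (Set.Icc a b)) :
    ∃ t : Finset (ℝ × ℝ), (∀ I ∈ t, I.1 < I.2 ∧ Set.Icc I.1 I.2 ⊆ Set.Icc a b ∧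
        μ.real (Set.Icc I.1 I.2 ∩ U) = c * μ.real (Set.Icc I.1 I.2)) ∧
      K ⊆ ⋃ I ∈ t, Set.Icc I.1 I.2 ∧ OverlapLE t (fun I => Set.Icc I.1 I.2) 2 := by
  have restrict_Icc : ∀ p q, (μ.restrict U).real (Set.Icc p q) = μ.real (Set.Icc p q ∩ U) :=
    fun _ _ => measureReal_restrict_apply measurableSet_Icc
  obtain ⟨t, ht, hKt, hoverlap⟩ := exists_isStoppingInterval_cover (ρ := μ.restrict U)
    (σ := μ) (c := c) hU hab hK hKU hKab (by rwa [restrict_Icc])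
  refine ⟨t, fun I hI => ⟨(ht I hI).lt, (ht I hI).subset_Icc, ?_⟩, hKt, hoverlap⟩
  obtain ⟨hlt, -, hle, hor⟩ := ht I hI
  rw [restrict_Icc] at hle hor
  refine hor.resolve_left fun hIU => ?_
  have hpos : 0 < μ.real (Set.Icc I.1 I.2) := measureReal_Icc_pos hlt
  rw [Set.inter_eq_left.2 hIU] at hle
  nlinarith

namespace ComparableOnIntervals

variable {μ ν : Measure ℝ} {δ ε γ θ η κ : ℝ} {a b c : ℝ} {U K : Set ℝ} [IsLocallyFiniteMeasure ν]

theorem one_right : ComparableOnIntervals μ ν δ 1 := fun a b F _ _ hFab _ => by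
  rw [one_mul]
  exact measureReal_mono hFab measure_Icc_lt_top.ne

theorem ofReal_mul_measure_le (h : ComparableOnIntervals μ ν δ κ) (hκ : 0 ≤ κ) {S G : Set ℝ}
    (hS : MeasurableSet S) (hG : MeasurableSet G)
    (hSG : ∀ x ∈ S, ∃ p q : ℝ, x ∈ Set.Ioo p q ∧
      μ.real (Set.Icc p q \ G) < δ * μ.real (Set.Icc p q)) :
    ENNReal.ofReal (1 - 2 * κ) * ν S ≤ ν G := by
  rcases eq_or_ne (ν G) ∞ with hGtop | hGfin
  · exact hGtop ▸ le_top
  rw [hS.measure_eq_iSup_isCompact ν, ENNReal.mul_iSup]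
  refine iSup_le fun K => ?_
  simp only [ENNReal.mul_iSup, iSup_le_iff]
  intro hKS hK
  obtain ⟨t, ht, hKt, hoverlap⟩ := exists_finset_Icc_cover_overlapLE_two hK
    (P := fun I => I.1 < I.2 ∧ μ.real (Set.Icc I.1 I.2 \ G) < δ * μ.real (Set.Icc I.1 I.2))
    fun x hx => by
      obtain ⟨p, q, hxpq, hlt⟩ := hSG x (hKS hx)
      exact ⟨(p, q), ⟨hxpq.1.trans hxpq.2, hlt⟩,
        mem_nhdsWithin_of_mem_nhds (Icc_mem_nhds hxpq.1 hxpq.2)⟩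
  set V := ⋃ I ∈ t, Set.Icc I.1 I.2
  have hVfin : ν V ≠ ∞ := (t.isCompact_biUnion fun _ _ => isCompact_Icc).measure_lt_top.ne
  have outside : ν.real (V ∩ Gᶜ) ≤ κ * (2 : ℕ) * ν.real V :=
    hoverlap.measureReal_biUnion_inter_le (fun _ _ => measurableSet_Icc) hVfin hκ fun I hI =>
      h (ht I hI).1 (measurableSet_Icc.diff hG) Set.sdiff_subset (ht I hI).2
  have inside : (1 - 2 * κ) * ν.real V ≤ ν.real G := by
    have hVG : ν.real (V ∩ G) ≤ ν.real G := measureReal_mono Set.inter_subset_right hGfin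
    have hsplit := measureReal_inter_add_sdiff (s := V) hG hVfin
    rw [Set.sdiff_eq] at hsplit
    push_cast at outside
    linarith
  calc ENNReal.ofReal (1 - 2 * κ) * ν K ≤ ENNReal.ofReal (1 - 2 * κ) * ν V := by gcongr
    _ = ENNReal.ofReal ((1 - 2 * κ) * ν.real V) := by
      rw [ENNReal.ofReal_mul' measureReal_nonneg, ofReal_measureReal hVfin]
    _ ≤ ν G := ENNReal.ofReal_le_of_le_toReal inside

variable [IsLocallyFiniteMeasure μ]

theorem symm (h : ComparableOnIntervals μ ν δ ε) : ComparableOnIntervals ν μ (1 - ε) (1 - δ) := by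
  intro a b F hab hF hFab hlt
  have compl : ∀ (ρ : Measure ℝ) [IsLocallyFiniteMeasure ρ],
      ρ.real (Set.Icc a b \ F) = ρ.real (Set.Icc a b) - ρ.real F := fun ρ _ =>
    measureReal_sdiff hFab hF measure_Icc_lt_top.ne
  by_contra! hgt
  have := h hab (measurableSet_Icc.diff hF) Set.sdiff_subset (by rw [compl]; linarith)
  rw [compl] at this
  linarith

theorem add_smul (h : ComparableOnIntervals μ ν δ ε) (hδε : δ ≤ ε) (e : NNReal) :
    ComparableOnIntervals μ (ν + e • μ) δ ε := by
  intro a b F hab hF hFab hlt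
  have hFfin : ∀ (ρ : Measure ℝ) [IsLocallyFiniteMeasure ρ], ρ F ≠ ∞ := fun ρ _ =>
    measure_ne_top_of_subset hFab measure_Icc_lt_top.ne
  have hμF : μ.real F ≤ ε * μ.real (Set.Icc a b) :=
    hlt.le.trans (mul_le_mul_of_nonneg_right hδε measureReal_nonneg)
  rw [measureReal_add_apply (hFfin ν) (hFfin _), measureReal_add_apply measure_Icc_lt_top.ne
    measure_Icc_lt_top.ne, measureReal_nnreal_smul_apply, measureReal_nnreal_smul_apply]
  nlinarith [h hab hF hFab hlt, mul_le_mul_of_nonneg_left hμF e.coe_nonneg]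

variable [NullSingletonClass μ]

theorem measureReal_le_of_isCompact [μ.IsOpenPosMeasure] (hγ : 0 < γ) (hγ1 : γ ≤ 1) (hθ0 : 0 ≤ θ)
    (hθ : θ ≤ 1) (hη : η ≤ 1) (h : ComparableOnIntervals μ ν γ θ)
    (h' : ComparableOnIntervals μ ν η ε) (hab : a < b) (hU : IsOpen U)
    (hlt : μ.real (Set.Icc a b ∩ U) < γ / 4 * η * μ.real (Set.Icc a b)) (hK : IsCompact K)
    (hKU : K ⊆ U) (hKab : K ⊆ Set.Icc a b) :
    ν.real K ≤ (1 + θ) / 2 * ε * ν.real (Set.Icc a b) := by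
  obtain ⟨t, ht, hKt, hoverlap⟩ := exists_cover_measureReal_inter_eq (c := γ / 2) hU hab hK hKU hKab
    (by linarith) (hlt.le.trans (mul_le_mul_of_nonneg_right (by nlinarith) measureReal_nonneg))
  set V := ⋃ I ∈ t, Set.Icc I.1 I.2
  have hVab : V ⊆ Set.Icc a b := Set.iUnion₂_subset fun I hI => (ht I hI).2.1
  have hVfin : ∀ (ρ : Measure ℝ) [IsLocallyFiniteMeasure ρ], ρ V ≠ ∞ := fun ρ _ =>
    measure_ne_top_of_subset hVab measure_Icc_lt_top.ne
  have hμV : μ.real V < η * μ.real (Set.Icc a b) := by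
    have hdense := hoverlap.mul_measureReal_biUnion_le (fun _ _ => measurableSet_Icc) (hVfin μ)
      (by linarith) fun I hI => (ht I hI).2.2.ge
    have hVU : μ.real (V ∩ U) ≤ μ.real (Set.Icc a b ∩ U) :=
      measureReal_mono (Set.inter_subset_inter_left U hVab)
        (measure_ne_top_of_subset Set.inter_subset_left measure_Icc_lt_top.ne)
    push_cast at hdense
    nlinarith
  have hνVU : ν.real (V ∩ U) ≤ (1 + θ) / 2 * ν.real V := by
    have hsparse : ∀ I ∈ t, ν.real (Set.Icc I.1 I.2 ∩ U) ≤ θ * ν.real (Set.Icc I.1 I.2) :=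
      fun I hI => h (ht I hI).1 (measurableSet_Icc.inter hU.measurableSet) Set.inter_subset_left
        ((ht I hI).2.2.trans_lt
          (mul_lt_mul_of_pos_right (half_lt_self hγ) (measureReal_Icc_pos (ht I hI).1)))
    have := hoverlap.mul_measureReal_biUnion_inter_le (fun _ _ => measurableSet_Icc) (hVfin ν) hθ
      hU.measurableSet hsparse
    push_cast at this
    linarith
  calc ν.real K ≤ ν.real (V ∩ U) :=
        measureReal_mono (Set.subset_inter hKt hKU)
          (measure_ne_top_of_subset Set.inter_subset_left (hVfin ν))
    _ ≤ (1 + θ) / 2 * ν.real V := hνVU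
    _ ≤ (1 + θ) / 2 * (ε * ν.real (Set.Icc a b)) := by
      gcongr
      exact h' hab (t.measurableSet_biUnion fun _ _ => measurableSet_Icc) hVab hμV
    _ = (1 + θ) / 2 * ε * ν.real (Set.Icc a b) := (mul_assoc _ _ _).symm

theorem mul [μ.IsOpenPosMeasure] (hγ : 0 < γ) (hγ1 : γ ≤ 1) (hθ0 : 0 ≤ θ) (hθ : θ ≤ 1)
    (hη : η ≤ 1) (h : ComparableOnIntervals μ ν γ θ) (h' : ComparableOnIntervals μ ν η ε) :
    ComparableOnIntervals μ ν (γ / 4 * η) ((1 + θ) / 2 * ε) := by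
  intro a b F hab hF hFab hlt
  have hFfin : ∀ (ρ : Measure ℝ) [IsLocallyFiniteMeasure ρ], ρ F ≠ ∞ := fun ρ _ =>
    measure_ne_top_of_subset hFab measure_Icc_lt_top.ne
  obtain ⟨U, hFU, hU, hUfin, hUlt⟩ := exists_isOpen_measureReal_lt (hFfin μ) hlt
  exact measureReal_le_of_forall_isCompact hF (hFfin ν) fun K hKF hK =>
    measureReal_le_of_isCompact hγ hγ1 hθ0 hθ hη h h' hab hU
      ((measureReal_mono Set.inter_subset_right hUfin).trans_lt hUlt) hK (hKF.trans hFU)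
      (hKF.trans hFab)

theorem pow [μ.IsOpenPosMeasure] (hγ : 0 < γ) (hγ1 : γ ≤ 1) (hθ0 : 0 ≤ θ) (hθ : θ ≤ 1)
    (h : ComparableOnIntervals μ ν γ θ) (k : ℕ) :
    ComparableOnIntervals μ ν ((γ / 4) ^ k) (((1 + θ) / 2) ^ k) := by
  induction k with
  | zero => simpa only [pow_zero] using one_right
  | succ k ih =>
    rw [pow_succ', pow_succ']
    exact mul hγ hγ1 hθ0 hθ (pow_le_one₀ (by linarith) (by linarith)) h ih

theorem symm_pow [μ.IsOpenPosMeasure] [NullSingletonClass ν] (hδ : 0 ≤ δ) (hδε : δ ≤ ε)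
    (hε : ε < 1) (h : ComparableOnIntervals μ ν δ ε) (k : ℕ) :
    ComparableOnIntervals ν μ (((1 - ε) / 4) ^ k) ((1 - δ / 2) ^ k) := by
  intro a b F hab hF hFab hlt
  obtain ⟨e, he, hlt_e⟩ := exists_pos_mul_lt (sub_pos.2 hlt) (μ.real F)
  lift e to NNReal using he.le
  have : IsLocallyFiniteMeasure (ν + e • μ) := isLocallyFiniteMeasure_add _ _
  have : (e • μ).IsOpenPosMeasure :=
    Measure.isOpenPosMeasure_smul μ (ENNReal.coe_ne_zero.2 (NNReal.coe_pos.1 he).ne')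
  have : (ν + e • μ).IsOpenPosMeasure :=
    (Measure.le_add_left le_rfl : e • μ ≤ ν + e • μ).isOpenPosMeasure
  have : NullSingletonClass (ν + e • μ) := ⟨fun x => by simp⟩
  have hpow := (h.add_smul hδε e).symm.pow (by linarith) (by linarith) (by linarith) (by linarith) k
  have hθ : (1 + (1 - δ)) / 2 = 1 - δ / 2 := by ring
  rw [hθ] at hpow
  refine hpow hab hF hFab ?_
  have hFfin : ∀ (ρ : Measure ℝ) [IsLocallyFiniteMeasure ρ], ρ F ≠ ∞ := fun ρ _ =>
    measure_ne_top_of_subset hFab measure_Icc_lt_top.ne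
  rw [measureReal_add_apply (hFfin ν) (hFfin _), measureReal_add_apply measure_Icc_lt_top.ne
    measure_Icc_lt_top.ne, measureReal_nnreal_smul_apply, measureReal_nnreal_smul_apply]
  have : 0 ≤ ((1 - ε) / 4) ^ k * (e * μ.real (Set.Icc a b)) := by
    have : 0 ≤ 1 - ε := by linarith
    positivity
  linarith

end ComparableOnIntervals

section FujiiWilson

/-- The measure `v(t) dt` attached to a weight `v` on the line. -/
noncomputable def lineMeasure (v : ℝ → ℝ) : Measure ℝ :=
  volume.withDensity fun t => ENNReal.ofReal (v t)

instance (v : ℝ → ℝ) : NullSingletonClass (lineMeasure v) :=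
  inferInstanceAs (NullSingletonClass (volume.withDensity _))

theorem sum_two_pow_mul_indicator_le {X : Type*} {f : X → ℝ≥0∞} {V : ℕ → Set X} {L : ℝ≥0∞} {N : ℕ}
    (hf : ∀ k < N, ∀ x ∈ V k, 2 ^ k * L ≤ f x) (x : X) :
    ∑ k ∈ Finset.range N, (V k).indicator (fun _ => 2 ^ k * L) x ≤ 2 * f x := by
  have geometric : ∀ n : ℕ, ∑ k ∈ Finset.range n, (2 : ℝ≥0∞) ^ k * L ≤ 2 ^ n * L := by
    intro n
    induction n with
    | zero => simp
    | succ n ih =>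
      rw [Finset.sum_range_succ, pow_succ, mul_two, add_mul]
      gcongr
  induction N with
  | zero => simp
  | succ N ih =>
    by_cases hx : x ∈ V N
    · calc ∑ k ∈ Finset.range (N + 1), (V k).indicator (fun _ => 2 ^ k * L) x
          ≤ ∑ k ∈ Finset.range (N + 1), (2 : ℝ≥0∞) ^ k * L :=
            Finset.sum_le_sum fun k _ => Set.indicator_le_self (V k) (fun _ => 2 ^ k * L) x
        _ ≤ 2 * (2 ^ N * L) := (geometric _).trans_eq (by rw [pow_succ', mul_assoc])
        _ ≤ 2 * f x := by gcongr; exact hf N N.lt_succ_self x hx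
    · rw [Finset.sum_range_succ, Set.indicator_of_notMem hx, add_zero]
      exact ih fun k hk => hf k (hk.trans N.lt_succ_self)

theorem natCast_mul_le_two_mul_lintegral {X : Type*} [MeasurableSpace X] {μ : Measure X}
    {f : X → ℝ≥0∞} {V : ℕ → Set X} (hV : ∀ k, MeasurableSet (V k)) {L m : ℝ≥0∞} {N : ℕ}
    (hf : ∀ k < N, ∀ x ∈ V k, 2 ^ k * L ≤ f x) (hm : ∀ k < N, m ≤ 2 ^ k * L * μ (V k)) :
    N * m ≤ 2 * ∫⁻ x, f x ∂μ :=
  calc N * m = ∑ _k ∈ Finset.range N, m := by simp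
    _ ≤ ∑ k ∈ Finset.range N, 2 ^ k * L * μ (V k) :=
        Finset.sum_le_sum fun k hk => hm k (Finset.mem_range.1 hk)
    _ = ∫⁻ x, ∑ k ∈ Finset.range N, (V k).indicator (fun _ => 2 ^ k * L) x ∂μ := by
        rw [lintegral_finsetSum _ fun k _ => measurable_const.indicator (hV k)]
        exact Finset.sum_congr rfl fun k _ => (lintegral_indicator_const (hV k) _).symm
    _ ≤ ∫⁻ x, 2 * f x ∂μ := lintegral_mono (sum_two_pow_mul_indicator_le hf)
    _ = 2 * ∫⁻ x, f x ∂μ := lintegral_const_mul' _ _ ENNReal.ofNat_ne_top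

variable {v : ℝ → ℝ} {a b : ℝ}

theorem lineMeasure_div_le_maximalOne {I : Set ℝ} {p q x : ℝ} (hpq : p < q)
    (hx : x ∈ Set.Icc p q) (hI : Set.Icc p q ⊆ I) :
    lineMeasure v (Set.Icc p q) / volume (Set.Icc p q) ≤ maximalOne (I.indicator v) x :=
  calc lineMeasure v (Set.Icc p q) / volume (Set.Icc p q)
      ≤ (∫⁻ y in Set.Icc p q, ‖I.indicator v y‖ₑ) / volume (Set.Icc p q) := by
        rw [lineMeasure, withDensity_apply _ measurableSet_Icc]
        refine ENNReal.div_le_div_right (setLIntegral_mono_ae' measurableSet_Icc ?_) _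
        filter_upwards with y hy
        rw [Set.indicator_of_mem (hI hy)]
        exact Real.ofReal_le_enorm _
    _ ≤ maximalOne (I.indicator v) x :=
        le_iSup₂_of_le p q (le_iSup₂_of_le hpq hx le_rfl)

variable [IsLocallyFiniteMeasure (lineMeasure v)]

theorem lintegral_maximalOne_le {A : ℝ≥0∞} (hA : aInftyConst v ≤ A) (hab : a < b)
    (h0 : lineMeasure v (Set.Icc a b) ≠ 0) :
    ∫⁻ x in Set.Icc a b, maximalOne ((Set.Icc a b).indicator v) x ≤
      A * lineMeasure v (Set.Icc a b) := by
  refine (ENNReal.div_le_iff h0 measure_Icc_lt_top.ne).1 (le_trans ?_ hA)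
  rw [lineMeasure, withDensity_apply _ measurableSet_Icc]
  exact le_iSup₂_of_le a b (le_iSup_of_le hab le_rfl)

theorem IsStoppingInterval.ofReal_le_maximalOne {U : Set ℝ} {c : ℝ} {J : ℝ × ℝ}
    (hJ : IsStoppingInterval ((lineMeasure v).restrict U) volume c U a b J) (hc : 0 ≤ c)
    (hJU : ¬Set.Icc J.1 J.2 ⊆ U) {x : ℝ} (hx : x ∈ Set.Icc J.1 J.2) :
    ENNReal.ofReal c ≤ maximalOne ((Set.Icc a b).indicator v) x := by
  refine le_trans ?_ (lineMeasure_div_le_maximalOne hJ.lt hx hJ.subset_Icc)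
  have hvol : volume (Set.Icc J.1 J.2) ≠ 0 := by simpa using hJ.lt
  rw [ENNReal.le_div_iff_mul_le (.inl hvol) (.inl measure_Icc_lt_top.ne)]
  calc ENNReal.ofReal c * volume (Set.Icc J.1 J.2)
      = ENNReal.ofReal (c * volume.real (Set.Icc J.1 J.2)) := by
        rw [ENNReal.ofReal_mul hc, ofReal_measureReal measure_Icc_lt_top.ne]
    _ = (lineMeasure v).restrict U (Set.Icc J.1 J.2) := by
        rw [← hJ.subset_or_eq.resolve_left hJU, ofReal_measureReal measure_Icc_lt_top.ne]
    _ ≤ lineMeasure v (Set.Icc J.1 J.2) := Measure.restrict_apply_le _ _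

theorem exists_subset_ofReal_le_maximalOne {U K : Set ℝ} {c : ℝ} (hab : a < b) (hU : IsOpen U)
    (hK : IsCompact K) (hKU : K ⊆ U) (hKab : K ⊆ Set.Icc a b) (hc : 0 ≤ c)
    (hroot : (lineMeasure v).real (Set.Icc a b) ≤ c * volume.real (Set.Icc a b)) :
    ∃ V, MeasurableSet V ∧ V ⊆ Set.Icc a b ∧
      (∀ x ∈ V, ENNReal.ofReal c ≤ maximalOne ((Set.Icc a b).indicator v) x) ∧
      (lineMeasure v).real K ≤ 2 * c * (volume.real V + volume.real (Set.Icc a b ∩ U)) := by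
  obtain ⟨t, ht, hKt, hoverlap⟩ := exists_isStoppingInterval_cover (σ := volume)
    (ρ := (lineMeasure v).restrict U) hU hab hK hKU hKab (le_trans (by
      rw [measureReal_restrict_apply measurableSet_Icc]
      exact measureReal_mono Set.inter_subset_left measure_Icc_lt_top.ne) hroot)
  let V := ⋃ I ∈ t, ⋃ _ : ¬Set.Icc I.1 I.2 ⊆ U, Set.Icc I.1 I.2
  let W := ⋃ I ∈ t, Set.Icc I.1 I.2
  have hVab : V ⊆ Set.Icc a b :=
    Set.iUnion₂_subset fun I hI => Set.iUnion_subset fun _ => (ht I hI).subset_Icc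
  have hWc : IsCompact W := t.isCompact_biUnion fun _ _ => isCompact_Icc
  refine ⟨V, t.measurableSet_biUnion fun _ _ => .iUnion fun _ => measurableSet_Icc, hVab, ?_, ?_⟩
  · intro x hx
    simp only [V, Set.mem_iUnion] at hx
    obtain ⟨I, hI, hIU, hxI⟩ := hx
    exact (ht I hI).ofReal_le_maximalOne hc hIU hxI
  have hWV : W ⊆ V ∪ Set.Icc a b ∩ U := Set.iUnion₂_subset fun I hI => by
    by_cases hIU : Set.Icc I.1 I.2 ⊆ U
    · exact (Set.subset_inter (ht I hI).subset_Icc hIU).trans Set.subset_union_right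
    · exact fun x hx => .inl (Set.mem_iUnion₂_of_mem hI (Set.mem_iUnion_of_mem hIU hx))
  calc (lineMeasure v).real K ≤ (lineMeasure v).real (W ∩ U) :=
        measureReal_mono (Set.subset_inter hKt hKU)
          (measure_ne_top_of_subset Set.inter_subset_left hWc.measure_lt_top.ne)
    _ ≤ c * (2 : ℕ) * volume.real W :=
        hoverlap.measureReal_biUnion_inter_le (fun _ _ => measurableSet_Icc)
          hWc.measure_lt_top.ne hc fun I hI => by
            rw [← measureReal_restrict_apply measurableSet_Icc]
            exact (ht I hI).le
    _ ≤ c * (2 : ℕ) * (volume.real V + volume.real (Set.Icc a b ∩ U)) := by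
        gcongr
        exact (measureReal_mono hWV (measure_ne_top_of_subset
          (Set.union_subset hVab Set.inter_subset_left) measure_Icc_lt_top.ne)).trans
          (measureReal_union_le _ _)
    _ = _ := by push_cast; ring

theorem exists_level_sets {U K : Set ℝ} {N : ℕ} (hab : a < b) (hU : IsOpen U) (hK : IsCompact K)
    (hKU : K ⊆ U) (hKab : K ⊆ Set.Icc a b)
    (hUlt : volume.real (Set.Icc a b ∩ U) ≤ (1 / 2) ^ (N + 3) * volume.real (Set.Icc a b))
    (hhalf : 1 / 2 * (lineMeasure v).real (Set.Icc a b) ≤ (lineMeasure v).real K) :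
    ∃ (L : ℝ) (V : ℕ → Set ℝ), 0 ≤ L ∧ (∀ k, MeasurableSet (V k)) ∧ (∀ k, V k ⊆ Set.Icc a b) ∧
      (∀ k, ∀ x ∈ V k, ENNReal.ofReal (2 ^ k * L) ≤ maximalOne ((Set.Icc a b).indicator v) x) ∧
      ∀ k < N, 1 / 8 * (lineMeasure v).real (Set.Icc a b) ≤ 2 ^ k * L * volume.real (V k) := by
  set ν := lineMeasure v
  set I := Set.Icc a b
  have hI : 0 < volume.real I := measureReal_Icc_pos hab
  let L := ν.real I / volume.real I
  have hL : 0 ≤ L := div_nonneg measureReal_nonneg measureReal_nonneg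
  have hLI : L * volume.real I = ν.real I := div_mul_cancel₀ _ hI.ne'
  have hroot : ∀ k : ℕ, ν.real I ≤ 2 ^ k * L * volume.real I := fun k => by
    rw [mul_assoc, hLI]
    exact le_mul_of_one_le_left measureReal_nonneg (one_le_pow₀ one_le_two)
  choose V hVm hVI hVM hVK using fun k => exists_subset_ofReal_le_maximalOne hab hU hK hKU hKab
    (by positivity : (0 : ℝ) ≤ 2 ^ k * L) (hroot k)
  refine ⟨L, V, hL, hVm, hVI, hVM, fun k hk => ?_⟩
  have hpow : (2 : ℝ) ^ k * (1 / 2) ^ (N + 3) ≤ 1 / 16 := by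
    calc (2 : ℝ) ^ k * (1 / 2) ^ (N + 3) ≤ 2 ^ k * (1 / 2) ^ (k + 4) :=
          mul_le_mul_of_nonneg_left
            (pow_le_pow_of_le_one (by norm_num) (by norm_num) (by lia)) (by positivity)
      _ = 1 / 16 := by rw [pow_add, ← mul_assoc, ← mul_pow]; norm_num
  have hsmall : 2 ^ k * L * volume.real (I ∩ U) ≤ 1 / 16 * ν.real I :=
    calc 2 ^ k * L * volume.real (I ∩ U)
        ≤ 2 ^ k * L * ((1 / 2) ^ (N + 3) * volume.real I) := by gcongr
      _ = 2 ^ k * (1 / 2) ^ (N + 3) * ν.real I := by rw [← hLI]; ring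
      _ ≤ 1 / 16 * ν.real I := by gcongr
  linarith [hVK k, measureReal_nonneg (μ := ν) (s := I)]

theorem comparableOnIntervals_lineMeasure {A : NNReal} (hA : aInftyConst v ≤ A) {N : ℕ}
    (hN : 16 * A < N) :
    ComparableOnIntervals volume (lineMeasure v) ((1 / 2) ^ (N + 3)) (1 / 2) := by
  intro a b F hab hF hFab hlt
  set ν := lineMeasure v
  set I := Set.Icc a b
  have hIfin : ν I ≠ ∞ := measure_Icc_lt_top.ne
  obtain ⟨U, hFU, hU, hUfin, hUlt⟩ := exists_isOpen_measureReal_lt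
    (measure_ne_top_of_subset hFab measure_Icc_lt_top.ne) hlt
  refine measureReal_le_of_forall_isCompact hF (measure_ne_top_of_subset hFab hIfin)
    fun K hKF hK => ?_
  by_contra! hhalf
  have hpos : 0 < ν.real I := by
    have := measureReal_mono (hKF.trans hFab) hIfin
    linarith [measureReal_nonneg (μ := ν) (s := K)]
  obtain ⟨L, V, hL, hVm, hVI, hVM, hVlarge⟩ := exists_level_sets hab hU hK (hKF.trans hFU)
    (hKF.trans hFab) ((measureReal_mono Set.inter_subset_right hUfin).trans hUlt.le) hhalf.le
  have ofReal_height : ∀ k : ℕ, (2 : ℝ≥0∞) ^ k * ENNReal.ofReal L = ENNReal.ofReal (2 ^ k * L) :=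
    fun k => by
      rw [ENNReal.ofReal_mul (by positivity), ENNReal.ofReal_pow zero_le_two, ENNReal.ofReal_ofNat]
  have hlayers : N * ENNReal.ofReal (1 / 8 * ν.real I) ≤ 2 * (A * ν I) := by
    refine (natCast_mul_le_two_mul_lintegral (μ := volume.restrict I)
      (f := maximalOne (I.indicator v)) (L := ENNReal.ofReal L) hVm (fun k _ x hx => ?_)
      fun k hk => ?_).trans (mul_le_mul_right (lintegral_maximalOne_le hA hab ?_) 2)
    · exact (ofReal_height k).symm ▸ hVM k x hx
    · rw [ofReal_height, Measure.restrict_apply (hVm k), Set.inter_eq_left.2 (hVI k),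
        ← ofReal_measureReal (measure_ne_top_of_subset (hVI k) measure_Icc_lt_top.ne),
        ← ENNReal.ofReal_mul (by positivity)]
      exact ENNReal.ofReal_le_ofReal (hVlarge k hk)
    · exact ((ENNReal.toReal_pos_iff.1 hpos).1).ne'
  have := ENNReal.toReal_mono (by finiteness) hlayers
  simp only [ENNReal.toReal_mul, ENNReal.toReal_natCast, ENNReal.toReal_ofNat,
    ENNReal.coe_toReal, ← measureReal_def,
    ENNReal.toReal_ofReal (by positivity : 0 ≤ 1 / 8 * ν.real I)] at this
  have hAN : 16 * (A : ℝ) < N := by exact_mod_cast hN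
  nlinarith [mul_pos (sub_pos.2 hAN) hpos]

end FujiiWilson

section Slicing

variable {ι : Type*} [DecidableEq ι]

/-- The point whose `j`-th coordinate is `t` and whose other coordinates are given by `y`, so that
`slice w j y` is `w ∘ insertCoord j y`. -/
def insertCoord (j : ι) (y : {i : ι // i ≠ j} → ℝ) (t : ℝ) : ι → ℝ :=
  fun i => if h : i = j then t else y ⟨i, h⟩

theorem insertCoord_same (j : ι) (y : {i : ι // i ≠ j} → ℝ) (t : ℝ) : insertCoord j y t j = t := by
  simp [insertCoord]

theorem update_insertCoord (j : ι) (y : {i : ι // i ≠ j} → ℝ) (t s : ℝ) :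
    Function.update (insertCoord j y t) j s = insertCoord j y s := by
  ext i
  by_cases h : i = j
  · subst h; simp [insertCoord]
  · simp [insertCoord, h]

theorem continuous_insertCoord (j : ι) (y : {i : ι // i ≠ j} → ℝ) :
    Continuous (insertCoord j y) := by
  refine continuous_pi fun i => ?_
  by_cases h : i = j <;> simp only [insertCoord, h, dite_true, dite_false] <;> fun_prop

theorem measurePreserving_funUnique_symm (κ : Type*) [Unique κ] [inst : Fintype κ] :
    MeasurePreserving (MeasurableEquiv.funUnique κ ℝ).symm volume (Measure.pi fun _ => volume) := by
  obtain rfl : inst = Unique.fintype := Subsingleton.elim _ _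
  exact (volume_preserving_funUnique κ ℝ).symm

theorem measurePreserving_insertCoord [Fintype ι] (j : ι) :
    MeasurePreserving (fun p : ({i : ι // i ≠ j} → ℝ) × ℝ => insertCoord j p.1 p.2)
      (volume.prod volume) volume := by
  let _ : Unique {i : ι // ¬ i ≠ j} := ⟨⟨⟨j, by simp⟩⟩, fun i => Subtype.ext (not_not.1 i.2)⟩
  have hcomp : (fun p : ({i : ι // i ≠ j} → ℝ) × ℝ => insertCoord j p.1 p.2) =
      (MeasurableEquiv.piEquivPiSubtypeProd (fun _ : ι => ℝ) (· ≠ j)).symm ∘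
        Prod.map id (MeasurableEquiv.funUnique {i : ι // ¬ i ≠ j} ℝ).symm := by
    funext p i
    by_cases h : i = j
    · subst h
      simp [insertCoord, MeasurableEquiv.piEquivPiSubtypeProd, Equiv.piEquivPiSubtypeProd,
        MeasurableEquiv.funUnique]
    · simp [insertCoord, h, MeasurableEquiv.piEquivPiSubtypeProd, Equiv.piEquivPiSubtypeProd]
  rw [hcomp]
  exact (volume_preserving_piEquivPiSubtypeProd (fun _ : ι => ℝ) (· ≠ j)).symm.comp
    ((MeasurePreserving.id volume).prod (measurePreserving_funUnique_symm _))

theorem isLocallyFiniteMeasure_withDensity_of_locallyIntegrable {X : Type*} [TopologicalSpace X]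
    [MeasurableSpace X] [OpensMeasurableSpace X] {μ : Measure X} {f : X → ℝ}
    (hf : LocallyIntegrable f μ) :
    IsLocallyFiniteMeasure (μ.withDensity fun x => ENNReal.ofReal (f x)) := by
  refine ⟨fun x => ?_⟩
  obtain ⟨s, hs, hfs⟩ := hf x
  obtain ⟨U, hUs, hU, hxU⟩ := mem_nhds_iff.1 hs
  refine ⟨U, hU.mem_nhds hxU, ?_⟩
  rw [withDensity_apply _ hU.measurableSet]
  exact (hfs.mono_set hUs).lintegral_lt_top

variable {n : ℕ} {w : (Fin n → ℝ) → ℝ}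

theorem weightMeasure_eq_lintegral_lineMeasure (hw : AEMeasurable w) (j : Fin n)
    {S : Set (Fin n → ℝ)} (hS : MeasurableSet S) :
    weightMeasure w S = ∫⁻ y, lineMeasure (slice w j y) (insertCoord j y ⁻¹' S) := by
  have hind : AEMeasurable (S.indicator fun x => ENNReal.ofReal (w x)) :=
    hw.ennreal_ofReal.indicator hS
  have hmp := measurePreserving_insertCoord j
  calc weightMeasure w S
      = ∫⁻ x, S.indicator (fun x => ENNReal.ofReal (w x)) x := by
        rw [weightMeasure, withDensity_apply _ hS, lintegral_indicator hS]
    _ = ∫⁻ y, ∫⁻ t, S.indicator (fun x => ENNReal.ofReal (w x)) (insertCoord j y t) := by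
        rw [← hmp.map_eq] at hind ⊢
        rw [lintegral_map' hind hmp.aemeasurable]
        exact lintegral_prod _ (hind.comp_measurable hmp.measurable)
    _ = ∫⁻ y, lineMeasure (slice w j y) (insertCoord j y ⁻¹' S) := by
        refine lintegral_congr fun y => ?_
        have hSy := (continuous_insertCoord j y).measurable hS
        rw [lineMeasure, withDensity_apply _ hSy, ← lintegral_indicator hSy]
        rfl

theorem ae_locallyIntegrable_slice (hw : LocallyIntegrable w) (j : Fin n) :
    ∀ᵐ y, LocallyIntegrable (slice w j y) := by
  have hball : ∀ᵐ y, ∀ m : ℕ, IntegrableOn (slice w j y)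
      (insertCoord j y ⁻¹' Metric.ball 0 m) := by
    refine ae_all_iff.2 fun m => ?_
    have hint : Integrable ((Metric.ball (0 : Fin n → ℝ) m).indicator w) :=
      ((hw.integrableOn_isCompact (isCompact_closedBall 0 (m : ℝ))).mono_set
        Metric.ball_subset_closedBall).integrable_indicator Metric.isOpen_ball.measurableSet
    filter_upwards [((measurePreserving_insertCoord j).integrable_comp_of_integrable
      hint).prod_right_ae] with y hy
    exact (integrable_indicator_iff (Metric.isOpen_ball.preimage
      (continuous_insertCoord j y)).measurableSet).1 hy
  filter_upwards [hball] with y hy t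
  obtain ⟨m, hm⟩ := exists_nat_gt ‖insertCoord j y t‖
  exact ⟨_, (Metric.isOpen_ball.preimage (continuous_insertCoord j y)).mem_nhds
    (by simpa using hm), hy m⟩

theorem ae_aInftyConst_slice_le (w : (Fin n → ℝ) → ℝ) (j : Fin n) :
    ∀ᵐ y, aInftyConst (slice w j y) ≤ strongAInftyConst w := by
  filter_upwards [ENNReal.ae_le_essSup fun y => aInftyConst (slice w j y)] with y hy
  exact hy.trans (le_iSup (fun j : Fin n =>
    essSup (fun y : {i : Fin n // i ≠ j} → ℝ => aInftyConst (slice w j y)) volume) j)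

end Slicing

section Filling

variable {ι : Type*} [DecidableEq ι]

theorem update_mem_Icc {a b x : ι → ℝ} (hx : x ∈ Set.Icc a b) {j : ι} {t : ℝ}
    (ht : t ∈ Set.Icc (a j) (b j)) : Function.update x j t ∈ Set.Icc a b :=
  ⟨le_update_iff.2 ⟨ht.1, fun i _ => hx.1 i⟩, update_le_iff.2 ⟨ht.2, fun i _ => hx.2 i⟩⟩

/-- The points lying in the interior of a segment parallel to the `j`-th axis of which `G` misses
less than the proportion `δ`. Only segments with rational end points are used, so that the
measurability of `G` is inherited. -/
def lineFill (δ : ℝ) (j : ι) (G : Set (ι → ℝ)) : Set (ι → ℝ) :=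
  {x | ∃ p q : ℚ, x j ∈ Set.Ioo (p : ℝ) q ∧
    volume.real (Set.Icc (p : ℝ) q \ {t | Function.update x j t ∈ G}) <
      δ * volume.real (Set.Icc (p : ℝ) q)}

/-- The points of the box `[a, b]` for which `G` misses at most the proportion `δ` of the whole
chord of `[a, b]` parallel to the `j`-th axis. -/
def chordFill (a b : ι → ℝ) (δ : ℝ) (j : ι) (G : Set (ι → ℝ)) : Set (ι → ℝ) :=
  {x ∈ Set.Icc a b | volume.real (Set.Icc (a j) (b j) \ {t | Function.update x j t ∈ G}) ≤
    δ * volume.real (Set.Icc (a j) (b j))}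

theorem measurable_measureReal_Icc_sdiff_update (p q : ℝ) (j : ι) {G : Set (ι → ℝ)}
    (hG : MeasurableSet G) :
    Measurable fun x : ι → ℝ => volume.real (Set.Icc p q \ {t | Function.update x j t ∈ G}) :=
  (measurable_measure_prodMk_left ((measurable_snd measurableSet_Icc).diff
    (measurable_update' hG))).ennreal_toReal

theorem measurableSet_lineFill (δ : ℝ) (j : ι) {G : Set (ι → ℝ)} (hG : MeasurableSet G) :
    MeasurableSet (lineFill δ j G) := by
  simp only [lineFill, Set.ofPred_exists]
  exact MeasurableSet.iUnion fun p => MeasurableSet.iUnion fun q =>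
    (measurableSet_Ioo.preimage (measurable_pi_apply j)).inter
      (measurableSet_lt (measurable_measureReal_Icc_sdiff_update p q j hG) measurable_const)

theorem measurableSet_chordFill [Countable ι] (a b : ι → ℝ) (δ : ℝ) (j : ι) {G : Set (ι → ℝ)}
    (hG : MeasurableSet G) : MeasurableSet (chordFill a b δ j G) :=
  measurableSet_Icc.inter
    (measurableSet_le (measurable_measureReal_Icc_sdiff_update _ _ j hG) measurable_const)

theorem chordFill_subset_lineFill {a b : ι → ℝ} {δ δ' : ℝ} (hδ : δ < δ') {j : ι} (hab : a j < b j)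
    {G H : Set (ι → ℝ)} (hHG : Set.Icc a b ∩ H ⊆ G) :
    chordFill a b δ j H ⊆ lineFill δ' j G := by
  rintro x ⟨hx, hchord⟩
  set A := Set.Icc (a j) (b j) \ {t | Function.update x j t ∈ H} with hA
  rw [Real.volume_real_Icc_of_le hab.le] at hchord
  have hδ_nonneg : 0 ≤ δ :=
    nonneg_of_mul_nonneg_left (measureReal_nonneg.trans hchord) (sub_pos.2 hab)
  set e := (δ' - δ) * (b j - a j) / 2 with he
  have he_pos : 0 < e := by have := mul_pos (sub_pos.2 hδ) (sub_pos.2 hab); positivity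
  obtain ⟨p, hep, hpa⟩ := exists_rat_btwn (show a j - e < a j by linarith)
  obtain ⟨q, hbq, hqe⟩ := exists_rat_btwn (show b j < b j + e by linarith)
  refine ⟨p, q, ⟨hpa.trans_le (hx.1 j), (hx.2 j).trans_lt hbq⟩, ?_⟩
  have hsub : Set.Icc (p : ℝ) q \ {t | Function.update x j t ∈ G} ⊆
      (Set.Icc (p : ℝ) (a j) ∪ Set.Icc (b j) q) ∪ A := by
    rintro t ⟨ht, htG⟩
    rcases le_total t (a j) with hta | hta
    · exact Or.inl (Or.inl ⟨ht.1, hta⟩)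
    rcases le_total (b j) t with htb | htb
    · exact Or.inl (Or.inr ⟨htb, ht.2⟩)
    · exact Or.inr ⟨⟨hta, htb⟩, fun htH => htG (hHG ⟨update_mem_Icc hx ⟨hta, htb⟩, htH⟩)⟩
  rw [Real.volume_real_Icc_of_le (by linarith : (p : ℝ) ≤ q)]
  calc volume.real (Set.Icc (p : ℝ) q \ {t | Function.update x j t ∈ G})
      ≤ volume.real (Set.Icc (p : ℝ) (a j) ∪ Set.Icc (b j) q ∪ A) :=
        measureReal_mono hsub (measure_union_ne_top
          (measure_union_ne_top measure_Icc_lt_top.ne measure_Icc_lt_top.ne)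
          (measure_ne_top_of_subset Set.sdiff_subset measure_Icc_lt_top.ne))
    _ ≤ (a j - p) + (q - b j) + volume.real A := by
        rw [← Real.volume_real_Icc_of_le hpa.le, ← Real.volume_real_Icc_of_le hbq.le]
        exact (measureReal_union_le _ _).trans (by gcongr; exact measureReal_union_le _ _)
    _ < δ' * (b j - a j) := by linarith
    _ ≤ δ' * (q - p) := by gcongr; linarith

theorem inter_foldr_chordFill_subset_foldr_lineFill {a b : ι → ℝ} (hab : ∀ i, a i < b i)
    {δ δ' : ℝ} (hδ : δ < δ') (G : Set (ι → ℝ)) (l : List ι) :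
    Set.Icc a b ∩ l.foldr (chordFill a b δ) G ⊆ l.foldr (lineFill δ') G := by
  induction l with
  | nil => exact Set.inter_subset_right
  | cons j l ih => exact Set.inter_subset_right.trans (chordFill_subset_lineFill hδ (hab j) ih)

theorem mem_foldr_chordFill_congr {a b : ι → ℝ} {δ : ℝ} {G : Set (ι → ℝ)} {l : List ι}
    {x x' : ι → ℝ} (hx : x ∈ Set.Icc a b) (hx' : x' ∈ Set.Icc a b) (h : ∀ i ∉ l, x i = x' i) :
    x ∈ l.foldr (chordFill a b δ) G ↔ x' ∈ l.foldr (chordFill a b δ) G := by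
  induction l generalizing x x' with
  | nil => rw [funext fun i => h i (by simp)]
  | cons j l ih =>
    have hchord : Set.Icc (a j) (b j) \ {t | Function.update x j t ∈ l.foldr (chordFill a b δ) G} =
        Set.Icc (a j) (b j) \ {t | Function.update x' j t ∈ l.foldr (chordFill a b δ) G} := by
      ext t
      refine and_congr_right fun ht => not_congr (ih (update_mem_Icc hx ht)
        (update_mem_Icc hx' ht) fun i hi => ?_)
      rcases eq_or_ne i j with rfl | hij
      · simp
      · simpa [hij] using h i (by simp [hij, hi])
    simp only [List.foldr_cons, chordFill, Set.mem_ofPred_eq, hx, hx', hchord]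

theorem measurableSet_foldr {X κ : Type*} [MeasurableSpace X] {f : κ → Set X → Set X}
    (hf : ∀ j G, MeasurableSet G → MeasurableSet (f j G)) {G : Set X} (hG : MeasurableSet G)
    (l : List κ) : MeasurableSet (l.foldr f G) :=
  List.foldrRecOn l f hG fun G hG j _ => hf j G hG

end Filling

section WeightedFilling

variable {n : ℕ} {w : (Fin n → ℝ) → ℝ} {δ κ η : ℝ} {a b : Fin n → ℝ} {G : Set (Fin n → ℝ)}

theorem ofReal_mul_weightMeasure_lineFill_le (hw : LocallyIntegrable w) {j : Fin n}
    (h : ∀ᵐ y, ComparableOnIntervals volume (lineMeasure (slice w j y)) δ κ) (hκ : 0 ≤ κ)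
    (hG : MeasurableSet G) :
    ENNReal.ofReal (1 - 2 * κ) * weightMeasure w (lineFill δ j G) ≤ weightMeasure w G := by
  have hwm := hw.aestronglyMeasurable.aemeasurable
  rw [weightMeasure_eq_lintegral_lineMeasure hwm j (measurableSet_lineFill δ j hG),
    weightMeasure_eq_lintegral_lineMeasure hwm j hG, ← lintegral_const_mul' _ _ (by simp)]
  refine lintegral_mono_ae ?_
  filter_upwards [h, ae_locallyIntegrable_slice hw j] with y hcomp hslice
  have : IsLocallyFiniteMeasure (lineMeasure (slice w j y)) :=
    isLocallyFiniteMeasure_withDensity_of_locallyIntegrable hslice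
  have hinsert := (continuous_insertCoord j y).measurable
  refine hcomp.ofReal_mul_measure_le hκ (hinsert (measurableSet_lineFill δ j hG)) (hinsert hG) ?_
  rintro t ⟨p, q, hpq, hmiss⟩
  rw [insertCoord_same] at hpq
  simp only [update_insertCoord] at hmiss
  exact ⟨p, q, hpq, hmiss⟩

theorem ofReal_mul_weightMeasure_sdiff_chordFill_le (hw : LocallyIntegrable w) {j : Fin n}
    (h : ∀ᵐ y, ComparableOnIntervals (lineMeasure (slice w j y)) volume η δ) (hη : 0 ≤ η)
    (hab : a j < b j) (hG : MeasurableSet G) :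
    ENNReal.ofReal η * weightMeasure w (Set.Icc a b \ chordFill a b δ j G) ≤
      weightMeasure w (Set.Icc a b \ G) := by
  have hwm := hw.aestronglyMeasurable.aemeasurable
  rw [weightMeasure_eq_lintegral_lineMeasure hwm j
      (measurableSet_Icc.diff (measurableSet_chordFill a b δ j hG)),
    weightMeasure_eq_lintegral_lineMeasure hwm j (measurableSet_Icc.diff hG),
    ← lintegral_const_mul' _ _ (by simp)]
  refine lintegral_mono_ae ?_
  filter_upwards [h, ae_locallyIntegrable_slice hw j] with y hcomp hslice
  have : IsLocallyFiniteMeasure (lineMeasure (slice w j y)) :=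
    isLocallyFiniteMeasure_withDensity_of_locallyIntegrable hslice
  set ν := lineMeasure (slice w j y)
  set I := Set.Icc (a j) (b j)
  rcases Set.eq_empty_or_nonempty (insertCoord j y ⁻¹' (Set.Icc a b \ chordFill a b δ j G))
    with hempty | ⟨t, htbox, htchord⟩
  · simp [hempty]
  have hmiss : δ * volume.real I < volume.real (I \ insertCoord j y ⁻¹' G) := by
    refine not_le.1 fun hle => htchord ⟨htbox, ?_⟩
    simp only [update_insertCoord]
    exact hle
  have hlarge : η * ν.real I ≤ ν.real (I \ insertCoord j y ⁻¹' G) :=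
    not_lt.1 fun hlt => hmiss.not_ge (hcomp hab
      (measurableSet_Icc.diff ((continuous_insertCoord j y).measurable hG)) Set.sdiff_subset hlt)
  have hI : ν I ≠ ∞ := measure_Icc_lt_top.ne
  calc ENNReal.ofReal η * ν (insertCoord j y ⁻¹' (Set.Icc a b \ chordFill a b δ j G))
      ≤ ENNReal.ofReal η * ν I := by
        gcongr
        exact fun s hs => insertCoord_same j y s ▸ ⟨hs.1.1 j, hs.1.2 j⟩
    _ = ENNReal.ofReal (η * ν.real I) := by rw [ENNReal.ofReal_mul hη, ofReal_measureReal hI]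
    _ ≤ ENNReal.ofReal (ν.real (I \ insertCoord j y ⁻¹' G)) := ENNReal.ofReal_le_ofReal hlarge
    _ = ν (I \ insertCoord j y ⁻¹' G) :=
        ofReal_measureReal (measure_ne_top_of_subset Set.sdiff_subset hI)
    _ ≤ ν (insertCoord j y ⁻¹' (Set.Icc a b \ G)) :=
        measure_mono fun s hs => ⟨update_insertCoord j y t s ▸ update_mem_Icc htbox hs.1, hs.2⟩

theorem ofReal_pow_mul_weightMeasure_foldr_lineFill_le (hw : LocallyIntegrable w)
    (h : ∀ j, ∀ᵐ y, ComparableOnIntervals volume (lineMeasure (slice w j y)) δ κ) (hκ : 0 ≤ κ)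
    (hG : MeasurableSet G) (l : List (Fin n)) :
    ENNReal.ofReal (1 - 2 * κ) ^ l.length * weightMeasure w (l.foldr (lineFill δ) G) ≤
      weightMeasure w G := by
  induction l with
  | nil => simp
  | cons j l ih =>
    rw [List.length_cons, pow_succ, mul_assoc]
    refine le_trans ?_ ih
    gcongr
    exact ofReal_mul_weightMeasure_lineFill_le hw (h j) hκ
      (measurableSet_foldr (fun j _ => measurableSet_lineFill δ j) hG l)

theorem ofReal_pow_mul_weightMeasure_sdiff_foldr_chordFill_le (hw : LocallyIntegrable w)
    (h : ∀ j, ∀ᵐ y, ComparableOnIntervals (lineMeasure (slice w j y)) volume η δ) (hη : 0 ≤ η)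
    (hab : ∀ i, a i < b i) (hG : MeasurableSet G) (l : List (Fin n)) :
    ENNReal.ofReal η ^ l.length * weightMeasure w (Set.Icc a b \ l.foldr (chordFill a b δ) G) ≤
      weightMeasure w (Set.Icc a b \ G) := by
  induction l with
  | nil => simp
  | cons j l ih =>
    rw [List.length_cons, pow_succ, mul_assoc]
    refine le_trans ?_ ih
    gcongr
    exact ofReal_mul_weightMeasure_sdiff_chordFill_le hw (h j) hη (hab j)
      (measurableSet_foldr (fun j _ => measurableSet_chordFill a b δ j) hG l)

theorem Icc_subset_foldr_lineFill (hw : LocallyIntegrable w) {δ' : ℝ} (hδ : δ < δ')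
    (h : ∀ j, ∀ᵐ y, ComparableOnIntervals (lineMeasure (slice w j y)) volume η δ) (hη : 0 ≤ η)
    (hab : ∀ i, a i < b i) (hG : MeasurableSet G)
    (hmiss : weightMeasure w (Set.Icc a b \ G) <
      ENNReal.ofReal η ^ n * weightMeasure w (Set.Icc a b)) :
    Set.Icc a b ⊆ (List.finRange n).foldr (lineFill δ') G := by
  refine fun x hx => inter_foldr_chordFill_subset_foldr_lineFill hab hδ G _ ⟨hx, ?_⟩
  by_contra hxchord
  have hall : Set.Icc a b \ (List.finRange n).foldr (chordFill a b δ) G = Set.Icc a b :=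
    sdiff_eq_left.2 <| Set.disjoint_left.2 fun x' hx' hx'chord => hxchord <|
      (mem_foldr_chordFill_congr hx' hx fun i hi => absurd (List.mem_finRange i) hi).1 hx'chord
  have hle := ofReal_pow_mul_weightMeasure_sdiff_foldr_chordFill_le hw h hη hab hG (List.finRange n)
  rw [hall, List.length_finRange] at hle
  exact hle.not_gt hmiss

theorem exists_Icc_of_lt_strongMaximal (hw : LocallyIntegrable w) {E : Set (Fin n → ℝ)}
    (hE : MeasurableSet E) {α : ℝ} {x : Fin n → ℝ}
    (hx : ENNReal.ofReal α < strongMaximal w (E.indicator fun _ => 1) x) :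
    ∃ a b : Fin n → ℝ, (∀ i, a i < b i) ∧ x ∈ Set.Icc a b ∧
      weightMeasure w (Set.Icc a b \ E) <
        ENNReal.ofReal (1 - α) * weightMeasure w (Set.Icc a b) := by
  simp only [strongMaximal, lt_iSup_iff] at hx
  obtain ⟨a, b, hab, hxR, hlt⟩ := hx
  refine ⟨a, b, hab, hxR, ?_⟩
  set μ := weightMeasure w
  have : IsLocallyFiniteMeasure μ := isLocallyFiniteMeasure_withDensity_of_locallyIntegrable hw
  set R := Set.Icc a b
  have hR : μ R ≠ ∞ := isCompact_Icc.measure_lt_top.ne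
  have hint : ∫⁻ y in R, ‖E.indicator (fun _ => (1 : ℝ)) y‖ₑ ∂μ = μ (R ∩ E) := by
    simp only [enorm_indicator_eq_indicator_enorm, enorm_one]
    rw [lintegral_indicator_const hE, one_mul, Measure.restrict_apply hE, Set.inter_comm]
  rw [hint] at hlt
  have hdense : α * μ.real R < μ.real (R ∩ E) :=
    calc α * μ.real R ≤ (ENNReal.ofReal α * μ R).toReal := by
          rw [ENNReal.toReal_mul, ENNReal.toReal_ofReal']
          exact mul_le_mul_of_nonneg_right (le_max_left α 0) measureReal_nonneg
      _ < μ.real (R ∩ E) := ENNReal.toReal_strict_mono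
          (measure_ne_top_of_subset Set.inter_subset_left hR) (ENNReal.mul_lt_of_lt_div hlt)
  have hsplit := measureReal_inter_add_sdiff (μ := μ) (s := R) hE hR
  rw [← ofReal_measureReal hR, ← ENNReal.ofReal_mul' measureReal_nonneg,
    ENNReal.lt_ofReal_iff_toReal_lt (measure_ne_top_of_subset Set.sdiff_subset hR),
    ← measureReal_def]
  linarith

theorem tauberianConst_le (hw : LocallyIntegrable w) {δ' α : ℝ} (hδ : δ < δ')
    (h : ∀ j, ∀ᵐ y, ComparableOnIntervals (lineMeasure (slice w j y)) volume η δ)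
    (h' : ∀ j, ∀ᵐ y, ComparableOnIntervals volume (lineMeasure (slice w j y)) δ' κ)
    (hη : 0 ≤ η) (hκ : 0 ≤ κ) (hκ_lt : 2 * κ < 1) (hα : 1 - α ≤ η ^ n) :
    tauberianConst w α ≤ (ENNReal.ofReal (1 - 2 * κ) ^ n)⁻¹ := by
  refine iSup₂_le fun E hE => iSup₂_le fun _ _ => ENNReal.div_le_of_le_mul ?_
  have hpos : ENNReal.ofReal (1 - 2 * κ) ^ n ≠ 0 :=
    pow_ne_zero _ (ENNReal.ofReal_pos.2 (by linarith)).ne'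
  refine (ENNReal.mul_le_iff_le_inv hpos (by finiteness)).1 ?_
  have hfill := ofReal_pow_mul_weightMeasure_foldr_lineFill_le hw h' hκ hE (List.finRange n)
  rw [List.length_finRange] at hfill
  refine le_trans ?_ hfill
  gcongr
  intro x hx
  obtain ⟨a, b, hab, hxR, hmiss⟩ := exists_Icc_of_lt_strongMaximal hw hE hx
  refine Icc_subset_foldr_lineFill hw hδ h hη hab hE (hmiss.trans_le ?_) hxR
  rw [← ENNReal.ofReal_pow hη]
  gcongr

end WeightedFilling

section Tauberian

theorem exists_comparableOnIntervals_pow (A : NNReal) :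
    ∃ δ σ η : ℝ, σ < δ ∧ 0 ≤ σ ∧ 0 < η ∧ η ≤ 1 ∧
      ∀ v, LocallyIntegrable v → aInftyConst v ≤ A → ∀ m : ℕ,
        ComparableOnIntervals volume (lineMeasure v) (δ ^ m) ((3 / 4) ^ m) ∧
        ComparableOnIntervals (lineMeasure v) volume (η ^ m) (σ ^ m) := by
  obtain ⟨N, hN⟩ := exists_nat_gt (16 * A)
  set γ : ℝ := (1 / 2) ^ (N + 3)
  have hγ_pos : 0 < γ := by positivity
  have hγ_le : γ ≤ 1 / 2 := pow_le_of_le_one (by norm_num) (by norm_num) (by omega)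
  obtain ⟨L, hL⟩ := exists_pow_lt_of_lt_one (by positivity : 0 < γ / 4)
    (by linarith : 1 - γ / 2 < 1)
  refine ⟨γ / 4, (1 - γ / 2) ^ L, (1 / 8) ^ L, hL, pow_nonneg (by linarith) L, by positivity,
    pow_le_one₀ (by norm_num) (by norm_num), fun v hv hA m => ?_⟩
  have : IsLocallyFiniteMeasure (lineMeasure v) :=
    isLocallyFiniteMeasure_withDensity_of_locallyIntegrable hv
  have hcomp : ComparableOnIntervals volume (lineMeasure v) γ (1 / 2) :=
    comparableOnIntervals_lineMeasure hA hN
  constructor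
  · convert hcomp.pow hγ_pos (by linarith) (by norm_num) (by norm_num) m using 2
    norm_num
  · convert hcomp.symm_pow hγ_pos.le hγ_le (by norm_num) (L * m) using 1
    · rw [pow_mul]; norm_num
    · rw [pow_mul]

theorem exists_tauberianConst_le (n : ℕ) (A : NNReal) :
    ∃ ρ : ℝ, 0 < ρ ∧ ρ < 1 ∧ ∀ (m : ℕ) (α : ℝ), 2 * (3 / 4 : ℝ) ^ m < 1 → 1 - α ≤ ρ ^ m →
      ∀ w : (Fin n → ℝ) → ℝ, LocallyIntegrable w → strongAInftyConst w ≤ A →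
        tauberianConst w α ≤ (ENNReal.ofReal (1 - 2 * (3 / 4) ^ m) ^ n)⁻¹ := by
  obtain ⟨δ, σ, η, hσδ, hσ, hη, hη_le, hcomp⟩ := exists_comparableOnIntervals_pow A
  have hηn : 0 < η ^ n := by positivity
  have hηn_le : η ^ n ≤ 1 := pow_le_one₀ hη.le hη_le
  refine ⟨η ^ n / 2, by positivity, by linarith, fun m α hm hα w hw hA => ?_⟩
  have hslices : ∀ j, ∀ᵐ y, LocallyIntegrable (slice w j y) ∧ aInftyConst (slice w j y) ≤ A :=
    fun j => (ae_locallyIntegrable_slice hw j).and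
      ((ae_aInftyConst_slice_le w j).mono fun y hy => hy.trans hA)
  have hm_ne : m ≠ 0 := by rintro rfl; norm_num at hm
  refine tauberianConst_le hw (pow_lt_pow_left₀ hσδ hσ hm_ne)
    (fun j => (hslices j).mono fun y hy => (hcomp _ hy.1 hy.2 m).2)
    (fun j => (hslices j).mono fun y hy => (hcomp _ hy.1 hy.2 m).1)
    (by positivity) (by positivity) hm ?_
  calc 1 - α ≤ (η ^ n / 2) ^ m := hα
    _ ≤ (η ^ n) ^ m := by gcongr; linarith
    _ = (η ^ m) ^ n := pow_right_comm η n m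

theorem exists_nat_le_pow_and_pow_le {ρ q x : ℝ} (hρ : 0 < ρ) (hρ_lt : ρ < 1) (hq : 0 < q)
    (hq_lt : q < 1) (hx : 0 < x) (hx_le : x ≤ 1) :
    ∃ m : ℕ, x ≤ ρ ^ m ∧ q ^ m ≤ q⁻¹ * x ^ Real.logb ρ q := by
  obtain ⟨m, hm_lt, hm_le⟩ := exists_nat_pow_near_of_lt_one hx hx_le hρ hρ_lt
  refine ⟨m, hm_le, ?_⟩
  rw [le_inv_mul_iff₀ hq, ← pow_succ']
  calc q ^ (m + 1) = (ρ ^ Real.logb ρ q) ^ (m + 1) := by rw [Real.rpow_logb hρ hρ_lt.ne hq]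
    _ = (ρ ^ (m + 1)) ^ Real.logb ρ q := Real.rpow_pow_comm hρ.le _ _
    _ ≤ x ^ Real.logb ρ q := Real.rpow_le_rpow (by positivity) hm_lt.le
        (Real.logb_pos_of_base_lt_one hρ hρ_lt hq hq_lt).le

theorem inv_one_sub_two_mul_pow_le {n : ℕ} {κ : ℝ} (hκ : 0 ≤ κ) (hκ_lt : 2 * κ < 1)
    (hnκ : 4 * n * κ ≤ 1) : ((1 - 2 * κ) ^ n)⁻¹ ≤ 1 + 4 * n * κ := by
  have hbernoulli : 1 - 2 * n * κ ≤ (1 - 2 * κ) ^ n := by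
    have := one_add_mul_le_pow (a := -(2 * κ)) (by linarith) n
    calc 1 - 2 * n * κ = 1 + n * -(2 * κ) := by ring
      _ ≤ (1 - 2 * κ) ^ n := by rwa [sub_eq_add_neg]
  have hnκ_nonneg : 0 ≤ n * κ := by positivity
  rw [inv_le_iff_one_le_mul₀' (pow_pos (by linarith) n)]
  calc 1 ≤ (1 - 2 * n * κ) * (1 + 4 * n * κ) := by nlinarith
    _ ≤ (1 - 2 * κ) ^ n * (1 + 4 * n * κ) := by gcongr

theorem inv_ofReal_one_sub_two_mul_pow_sub_one_le {n : ℕ} {κ : ℝ} (hκ : 0 ≤ κ)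
    (hκ_lt : 2 * κ < 1) (hnκ : 4 * n * κ ≤ 1) :
    (ENNReal.ofReal (1 - 2 * κ) ^ n)⁻¹ - 1 ≤ ENNReal.ofReal (4 * n * κ) := by
  have hpow : 0 < (1 - 2 * κ) ^ n := pow_pos (by linarith) n
  rw [← ENNReal.ofReal_pow (by linarith), ← ENNReal.ofReal_inv_of_pos hpow, tsub_le_iff_left,
    ← ENNReal.ofReal_one, ← ENNReal.ofReal_add zero_le_one (by positivity)]
  exact ENNReal.ofReal_le_ofReal (inv_one_sub_two_mul_pow_le hκ hκ_lt hnκ)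

theorem eventually_mul_one_sub_rpow_lt_one (K : ℝ) {c : ℝ} (hc : 0 < c) :
    ∀ᶠ α : ℝ in 𝓝[<] 1, K * (1 - α) ^ c < 1 := by
  have hcont : Continuous fun α : ℝ => K * (1 - α) ^ c :=
    continuous_const.mul ((Real.continuous_rpow_const hc.le).comp (by fun_prop))
  exact (hcont.continuousAt.eventually_lt_const (by simp [hc.ne'])).filter_mono nhdsWithin_le_nhds

theorem theorem3_general (n : ℕ) (A : NNReal) :
    ∃ c : ℝ, 0 < c ∧ ∃ K : ℝ, 0 < K ∧
      ∀ᶠ α : ℝ in 𝓝[<] 1, ∀ w : (Fin n → ℝ) → ℝ, LocallyIntegrable w →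
        strongAInftyConst w ≤ A → tauberianConst w α - 1 ≤ ENNReal.ofReal (K * (1 - α) ^ c) := by
  obtain ⟨ρ, hρ, hρ_lt, hbound⟩ := exists_tauberianConst_le n A
  set c := Real.logb ρ (3 / 4)
  have hc : 0 < c := Real.logb_pos_of_base_lt_one hρ hρ_lt (by norm_num) (by norm_num)
  set K : ℝ := (4 * n + 4) * (3 / 4)⁻¹
  refine ⟨c, hc, K, by positivity, ?_⟩
  filter_upwards [eventually_mul_one_sub_rpow_lt_one K hc, Ioo_mem_nhdsLT zero_lt_one]
    with α hKα hα w hw hA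
  obtain ⟨m, hαm, hm⟩ := exists_nat_le_pow_and_pow_le (q := 3 / 4) hρ hρ_lt (by norm_num)
    (by norm_num) (sub_pos.2 hα.2) (by linarith [hα.1])
  set κ : ℝ := (3 / 4) ^ m
  have hκ : 0 < κ := by positivity
  have hnκ : 0 ≤ 4 * n * κ := by positivity
  have hκK : 4 * n * κ + 4 * κ ≤ K * (1 - α) ^ c :=
    calc 4 * n * κ + 4 * κ = (4 * n + 4) * κ := by ring
      _ ≤ (4 * n + 4) * ((3 / 4)⁻¹ * (1 - α) ^ c) := by gcongr
      _ = K * (1 - α) ^ c := by ring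
  calc tauberianConst w α - 1
      ≤ (ENNReal.ofReal (1 - 2 * κ) ^ n)⁻¹ - 1 :=
        tsub_le_tsub_right (hbound m α (by linarith) hαm w hw hA) 1
    _ ≤ ENNReal.ofReal (4 * n * κ) :=
        inv_ofReal_one_sub_two_mul_pow_sub_one_le hκ.le (by linarith) (by linarith)
    _ ≤ ENNReal.ofReal (K * (1 - α) ^ c) := ENNReal.ofReal_le_ofReal (by linarith)

end Tauberian

theorem theorem3 {n : ℕ} (w : (Fin n → ℝ) → ℝ) (hw : IsStrongAInfty w) :
    ∃ c : ℝ, 0 < c ∧ ∃ K : ℝ, 0 < K ∧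
      ∀ᶠ α : ℝ in 𝓝[<] 1,
        tauberianConst w α - 1 ≤ ENNReal.ofReal (K * (1 - α) ^ c) := by
  obtain ⟨c, hc, K, hK, h⟩ := theorem3_general n (strongAInftyConst w).toNNReal
  exact ⟨c, hc, K, hK, h.mono fun α hα =>
    hα w hw.locallyIntegrable (ENNReal.coe_toNNReal hw.const_lt_top.ne).ge⟩
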